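/- A solution is a pair $(X,r)$, where $X$ is a set and $r:X\times X\to X\times X$, $r(x,y)=({}^xy,x^y)$, is an involutive map ($r^2=\mathrm{id}$) that satisfies the braid relation $r^{12}r^{23}r^{12}=r^{23}r^{12}r^{23}$ on $X\times X\times X$ and is nondegenerate: for every $x\in X$ the maps $\mathcal L_x:y\mapsto {}^xy$ and $\mathcal R_x:y\mapsto y^x$ are bijections of $X$. It is square-free if $r(x,x)=(x,x)$ for all $x\in X$. The cyclic degree $p=p(X,r)$ of a finite solution is the least common multiple of the orders of the permutations $\mathcal L_x$, $x\in X$. The group $G=G(X,r)$ is generated by $X$ with the defining relations $xy=zt$ whenever $r(x,y)=(z,t)\neq(x,y)$. **Theorem A.** Let $(X,r)$ be a finite square-free solution with $|X|=n$ and cyclic degree $p$, and let $G=G(X,r)$. Let $X=\{x_1<\dots<x_n\}$ be an enumeration of $X$ such that for all $i<j$ one has $r(x_j,x_i)=(x_{i'},x_{j'})$ with $i'<j'$ and $i'<j$ (for example, any enumeration for which the algebra $\mathbf k\langle X\mid xy=zt \text{ whenever } r(x,y)=(z,t)\rangle$ is a binomial skew polynomial ring). Let $\mathcal F_p$ be the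 subgroup of $G$ generated by $x_1^p,\dots,x_n^p$, and let $Y=\{x_1^{\alpha_1}\cdots x_n^{\alpha_n}: 0\le\alpha_i\le p-1 \text{ for } 1\le i\le n\}\subseteq G$. Then: 1. Every $u\in G$ can be written in a unique way as $u=y\,W$ with $y\in Y$ and $W\in\mathcal F_p$. 2. In particular, for all $y,z\in Y$ there exist uniquely determined $t\in Y$ and $W\in\mathcal F_p$ such that $y\,z=t\,W$ in $G$. 3. $Y$ has exactly $p^n$ elements, $G=\bigcup_{y\in Y}y\mathcal F_p$, and $y\mathcal F_p\cap t\mathcal F_p=\emptyset$ for all $y\ne t$ in $Y$. Thus $G$ is the disjoint union of the $p^n$ cosets $y\mathcal F_p$, $y\in Y$. -/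

import Mathlib

open scoped Pointwise

namespace YBE

variable {X : Type*}

/-- `r¹² = r × id` on `X × X × X`. -/
def r12 (r : X × X → X × X) (t : X × X × X) : X × X × X :=
  ((r (t.1, t.2.1)).1, (r (t.1, t.2.1)).2, t.2.2)

/-- `r²³ = id × r` on `X × X × X`. -/
def r23 (r : X × X → X × X) (t : X × X × X) : X × X × X :=
  (t.1, r t.2)

/-- A solution: a nondegenerate involutive set-theoretic solution of the Yang-Baxter equation.
Writing `r (x, y) = (ˣy, xʸ)`, the left action is `L_x y = ˣy` and the right action is
`R_y x = xʸ`. (Bijectivity of `r` follows from involutivity.) -/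
structure IsSolution (r : X × X → X × X) : Prop where
  left_bijective : ∀ x : X, Function.Bijective fun y : X => (r (x, y)).1
  right_bijective : ∀ y : X, Function.Bijective fun x : X => (r (x, y)).2
  involutive : Function.Involutive r
  braid : r12 r ∘ r23 r ∘ r12 r = r23 r ∘ r12 r ∘ r23 r

/-- `(X, r)` is square-free. -/
def IsSquareFree (r : X × X → X × X) : Prop :=
  ∀ x : X, r (x, x) = (x, x)

/-- The permutation `L_x : y ↦ ˣy` of `X`. -/
noncomputable def IsSolution.leftPerm {r : X × X → X × X} (h : IsSolution r) (x : X) :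
    Equiv.Perm X :=
  Equiv.ofBijective (fun y : X => (r (x, y)).1) (h.left_bijective x)

/-- The cyclic degree of a finite solution: the least common multiple of the orders of the
permutations `L_x`, `x ∈ X`. -/
noncomputable def IsSolution.cyclicDegree [Fintype X] {r : X × X → X × X} (h : IsSolution r) : ℕ :=
  Finset.univ.lcm fun x : X => orderOf (h.leftPerm x)

/-- The defining relations `x y = z t`, one for each pair with `r (x, y) = (z, t) ≠ (x, y)`. -/
def relators (r : X × X → X × X) : Set (FreeGroup X) :=
  {w | ∃ x y z t : X, r (x, y) = (z, t) ∧ (x, y) ≠ (z, t) ∧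
    w = FreeGroup.of x * FreeGroup.of y * (FreeGroup.of z * FreeGroup.of t)⁻¹}

/-- The group `G(X, r)` associated with `(X, r)`. -/
abbrev StructureGroup (r : X × X → X × X) : Type _ :=
  PresentedGroup (relators r)

/-- The image in `G(X, r)` of the generator `x ∈ X`. -/
def gen (r : X × X → X × X) (x : X) : StructureGroup r :=
  PresentedGroup.of x

/-- The subgroup of `G(X, r)` generated by the powers `x ^ p`, `x ∈ X`. -/
def powerSubgroup (r : X × X → X × X) (p : ℕ) : Subgroup (StructureGroup r) :=
  Subgroup.closure (Set.range fun x : X => gen r x ^ p)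

/-- The enumeration `x_1 < ⋯ < x_n` of `X` puts the quadratic relations of `(X, r)` into the form
required of the relations of a binomial skew polynomial ring: for `i < j` the relation with left
side `x_j x_i` reads `x_j x_i = x_{i'} x_{j'}` with `i' < j'` and `i' < j`. This is all that is
asked of the enumeration: that every ordered monomial `x_i x_j` with `i < j` occurs on a right hand
side, and that these relations form a Gröbner basis, is not assumed. -/
def IsBinomialEnumeration (r : X × X → X × X) {n : ℕ} (e : Fin n ≃ X) : Prop :=
  ∀ i j i' j' : Fin n, i < j → r (e j, e i) = (e i', e j') → i' < j' ∧ i' < j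

/-- The element `x_1 ^ α_1 ⋯ x_n ^ α_n` of `G(X, r)` (product in this order). -/
def orderedMonomial (r : X × X → X × X) {n : ℕ} (e : Fin n ≃ X) (α : Fin n → ℕ) :
    StructureGroup r :=
  (List.ofFn fun i : Fin n => gen r (e i) ^ α i).prod

/-- The set `Y` of the elements `x_1 ^ α_1 ⋯ x_n ^ α_n` of `G(X, r)` with `0 ≤ α_i ≤ p - 1`
for all `i`. -/
def Y (r : X × X → X × X) {n : ℕ} (e : Fin n ≃ X) (p : ℕ) : Set (StructureGroup r) :=
  {u | ∃ α : Fin n → ℕ, (∀ i, α i < p) ∧ u = orderedMonomial r e α}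

end YBE

/-! Existence is rewriting modulo `F_p`, and uniqueness is counting. The cyclic condition gives `y
x^p = (L_y x)^p y`, so `F_p` is normal. In the quotient the generators have finite order, so every
element is a positive word; replacing descents sorts it, and exponents reduce mod `p`. For
uniqueness, `G` acts on `(ℤ/p)^X` by `x : v ↦ e_x + v ∘ L_x⁻¹`. `F_p` acts trivially and the orbit
of `0` is everything. The `p^n` exponent vectors thus map onto the `p^n` points, hence bijectively,
and a coset `y F_p` determines `y`. -/

namespace YBE

/-! ### Sorting words in a monoid -/

section Words

variable {M : Type*} [Monoid M] {n : ℕ}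

/-- If every descent `g j * g i`, `i < j`, of a family can be rewritten as a product of two members
whose first index is smaller than `j`, then every product of members is a sorted one. -/
theorem exists_sorted_prod_eq {g : Fin n → M}
    (hg : ∀ i j, i < j → ∃ i' j', i' < j ∧ g j * g i = g i' * g j') (l : List (Fin n)) :
    ∃ l' : List (Fin n), l'.Pairwise (· ≤ ·) ∧ (l.map g).prod = (l'.map g).prod := by
  suffices H : ∀ k, ∀ l : List (Fin n), l.length = k →
      ∃ l' : List (Fin n), l'.length = k ∧ l'.Pairwise (· ≤ ·) ∧
        (l.map g).prod = (l'.map g).prod by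
    obtain ⟨l', -, h⟩ := H _ l rfl
    exact ⟨l', h⟩
  intro k
  induction k with
  | zero =>
    intro l hl
    exact ⟨l, hl, by simp [List.length_eq_zero_iff.1 hl]⟩
  | succ k ih =>
    -- Inner induction on the first letter: sort the tail; if a descent remains at the front,
    -- rewriting it strictly lowers the first letter and keeps the length.
    suffices H : ∀ a : Fin n, ∀ w : List (Fin n), w.length = k →
        ∃ l' : List (Fin n), l'.length = k + 1 ∧ l'.Pairwise (· ≤ ·) ∧
          g a * (w.map g).prod = (l'.map g).prod by
      intro l hl
      obtain ⟨a, w, rfl⟩ := List.exists_cons_of_length_eq_add_one hl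
      simpa using H a w (by simpa using hl)
    intro a
    induction a using WellFoundedLT.induction with
    | _ a iha =>
    intro w hw
    obtain ⟨w', hw', hs, hp⟩ := ih w hw
    cases w' with
    | nil => exact ⟨[a], by simpa [eq_comm] using hw', by simp, by simp [hp]⟩
    | cons b v =>
      by_cases hab : a ≤ b
      · refine ⟨a :: b :: v, by simpa using hw', ?_, by simp [hp]⟩
        refine List.pairwise_cons.2 ⟨?_, hs⟩
        intro c hc
        rcases List.mem_cons.1 hc with rfl | hc
        · exact hab
        · exact hab.trans (List.rel_of_pairwise_cons hs hc)
      · obtain ⟨i', j', hlt, heq⟩ := hg b a (not_le.1 hab)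
        obtain ⟨l', h1, h2, h3⟩ := iha i' hlt (j' :: v) (by simpa using hw')
        refine ⟨l', h1, h2, ?_⟩
        rw [← h3, hp]
        simp only [List.map_cons, List.prod_cons]
        rw [← mul_assoc, heq, mul_assoc]

/-- A sorted list is determined by its multiplicities. -/
theorem prod_map_eq_prod_ofFn_pow_count {l : List (Fin n)} (hl : l.Pairwise (· ≤ ·))
    (g : Fin n → M) : (l.map g).prod = (List.ofFn fun i => g i ^ l.count i).prod := by
  have hperm : l = (List.finRange n).flatMap fun i => List.replicate (l.count i) i := by
    refine List.Perm.eq_of_pairwise (le := (· ≤ ·)) (fun a b _ _ h h' => le_antisymm h h') hl ?_ ?_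
    · refine List.pairwise_flatMap.2 ⟨fun i _ => ?_, ?_⟩
      · exact List.pairwise_replicate.2 (Or.inr le_rfl)
      · refine (List.pairwise_lt_finRange n).imp ?_
        intro a b hab x hx y hy
        rw [List.eq_of_mem_replicate hx, List.eq_of_mem_replicate hy]
        exact hab.le
    · refine List.perm_iff_count.2 fun i => ?_
      rw [List.count_flatMap, ← List.ofFn_eq_map, List.sum_ofFn]
      simp [List.count_replicate]
  conv_lhs => rw [hperm]
  rw [List.map_flatMap, List.flatMap, List.prod_flatten, List.map_map, List.ofFn_eq_map]
  congr 1
  refine List.map_congr_left fun i _ => ?_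
  simp

end Words

/-! ### The left action and the cyclic condition -/

section Solution

variable {X : Type*} {r : X × X → X × X}

namespace IsSolution

theorem leftPerm_apply (h : IsSolution r) (x y : X) : h.leftPerm x y = (r (x, y)).1 := rfl

theorem leftPerm_self (h : IsSolution r) (hsf : IsSquareFree r) (x : X) : h.leftPerm x x = x := by
  rw [leftPerm_apply, hsf x]

/-- First component of the braid relation at `(x, y, w)`. -/
theorem leftPerm_mul (h : IsSolution r) (x y : X) :
    h.leftPerm x * h.leftPerm y = h.leftPerm (r (x, y)).1 * h.leftPerm (r (x, y)).2 := by
  ext w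
  exact (congrArg Prod.fst (congrFun h.braid (x, y, w))).symm

theorem leftPerm_fst_snd (h : IsSolution r) (x y : X) :
    h.leftPerm (r (x, y)).1 (r (x, y)).2 = x :=
  congrArg Prod.fst (h.involutive (x, y))

/-- The cyclic condition: `L_z x = L_y x` for `z = yˣ`, in a square-free solution. -/
theorem fst_snd_eq_fst (h : IsSolution r) (hsf : IsSquareFree r) (y x : X) :
    (r ((r (y, x)).2, x)).1 = (r (y, x)).1 := by
  -- With `r (y, x) = (z, t)`, evaluating `L_y L_x = L_z L_t` at `x` gives `z = L_z (L_t x)`, while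
  -- `z = L_z z`.
  have h1 := congrArg (fun σ : Equiv.Perm X => σ x) (h.leftPerm_mul y x)
  simp only [Equiv.Perm.mul_apply, h.leftPerm_self hsf x] at h1
  apply (h.leftPerm (r (y, x)).1).injective
  rw [h.leftPerm_self hsf]
  exact h1.symm

theorem cyclicDegree_pos [Fintype X] (h : IsSolution r) : 0 < h.cyclicDegree :=
  Nat.pos_of_ne_zero <| Finset.lcm_ne_zero_iff.2 fun x _ => (orderOf_pos (h.leftPerm x)).ne'

theorem leftPerm_pow_cyclicDegree [Fintype X] (h : IsSolution r) (x : X) :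
    h.leftPerm x ^ h.cyclicDegree = 1 :=
  orderOf_dvd_iff_pow_eq_one.1 (Finset.dvd_lcm (Finset.mem_univ x))

end IsSolution

/-! ### Powers of generators in the structure group -/

theorem gen_mul_gen (r : X × X → X × X) (x y : X) :
    gen r x * gen r y = gen r (r (x, y)).1 * gen r (r (x, y)).2 := by
  by_cases hxy : (x, y) = r (x, y)
  · rw [← hxy]
  · refine mul_inv_eq_one.1 ?_
    exact PresentedGroup.one_of_mem ⟨x, y, _, _, rfl, hxy, rfl⟩

theorem closure_range_gen (r : X × X → X × X) : Subgroup.closure (Set.range (gen r)) = ⊤ :=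
  PresentedGroup.closure_range_of (relators r)

/-- Moving a generator past a power: `y xᵏ = (L_y x)ᵏ y'` for a translate `y'` of `y` under
powers of `L_z`, `z = L_y x`. -/
theorem gen_mul_gen_pow (h : IsSolution r) (hsf : IsSquareFree r) (x y : X) (k : ℕ) :
    gen r y * gen r x ^ k =
      gen r (r (y, x)).1 ^ k * gen r (((h.leftPerm (r (y, x)).1) ^ k)⁻¹ y) := by
  induction k generalizing y with
  | zero => simp
  | succ k ih =>
    -- With `r (y, x) = (z, t)`, the cyclic condition `L_t x = z` makes the next swap produce the
    -- same `z`.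
    rw [pow_succ', ← mul_assoc, gen_mul_gen, mul_assoc, ih, h.fst_snd_eq_fst hsf, ← mul_assoc,
      ← pow_succ']
    congr 2
    have : (r (y, x)).2 = (h.leftPerm (r (y, x)).1)⁻¹ y := by
      rw [Equiv.Perm.eq_inv_iff_eq]
      exact h.leftPerm_fst_snd y x
    rw [this, ← Equiv.Perm.mul_apply, ← mul_inv_rev, ← pow_succ']

/-- Conjugation by `y` permutes the generators `x^p` as `L_y` permutes `X`; surjectivity of `L_y`
handles conjugation by `y⁻¹`. -/
theorem powerSubgroup_normal (h : IsSolution r) (hsf : IsSquareFree r) {p : ℕ}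
    (hp : ∀ x, h.leftPerm x ^ p = 1) : (powerSubgroup r p).Normal := by
  have conj (y x : X) :
      gen r y * gen r x ^ p * (gen r y)⁻¹ = gen r (h.leftPerm y x) ^ p := by
    rw [gen_mul_gen_pow h hsf, hp]
    simp [IsSolution.leftPerm_apply]
  have hmem (x : X) : gen r x ^ p ∈ powerSubgroup r p := Subgroup.subset_closure ⟨x, rfl⟩
  rw [← Subgroup.normalizer_eq_top_iff, eq_top_iff, ← closure_range_gen r, Subgroup.closure_le]
  rintro _ ⟨y, rfl⟩
  rw [SetLike.mem_coe, Subgroup.mem_normalizer_iff]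
  intro u
  constructor
  · intro hu
    have : powerSubgroup r p ≤
        (powerSubgroup r p).comap (MulAut.conj (gen r y)).toMonoidHom := by
      refine (Subgroup.closure_le _).2 ?_
      rintro _ ⟨x, rfl⟩
      change gen r y * gen r x ^ p * (gen r y)⁻¹ ∈ powerSubgroup r p
      rw [conj]
      exact hmem _
    exact this hu
  · intro hu
    have : powerSubgroup r p ≤
        (powerSubgroup r p).comap (MulAut.conj (gen r y)⁻¹).toMonoidHom := by
      refine (Subgroup.closure_le _).2 ?_
      rintro _ ⟨x, rfl⟩
      change (gen r y)⁻¹ * gen r x ^ p * (gen r y)⁻¹⁻¹ ∈ powerSubgroup r p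
      obtain ⟨z, rfl⟩ := (h.leftPerm y).surjective x
      rw [← conj]
      simpa [mul_assoc] using hmem z
    simpa [mul_assoc] using this hu

/-! ### The affine action on `(ℤ/p)^X` -/

section AffineAction

open Classical in
/-- The affine map `v ↦ e_x + v ∘ L_x⁻¹` of the space of functions `X → ℤ/p`. -/
noncomputable def IsSolution.affinePerm (h : IsSolution r) (p : ℕ) (x : X) :
    Equiv.Perm (X → ZMod p) :=
  (Equiv.arrowCongr (h.leftPerm x) (Equiv.refl (ZMod p))).trans (Equiv.addLeft (Pi.single x 1))

open Classical in
theorem IsSolution.affinePerm_apply (h : IsSolution r) (p : ℕ) (x : X) (v : X → ZMod p) :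
    h.affinePerm p x v = Pi.single x 1 + v ∘ ⇑(h.leftPerm x)⁻¹ := rfl

open Classical in
theorem single_comp_inv {R : Type*} [Zero R] (σ : Equiv.Perm X) (x : X) (a : R) :
    (Pi.single x a : X → R) ∘ ⇑σ⁻¹ = Pi.single (σ x) a := by
  ext y
  simp [Pi.single_apply, Equiv.symm_apply_eq]

/-- If `r (x, y) = (z, t)`, the linear parts agree by the braid relation; the translations `e_x +
e_{L_x y}` and `e_z + e_{L_z t}` agree because `L_x y = z` and `L_z t = x`. -/
theorem IsSolution.affinePerm_mul (h : IsSolution r) (p : ℕ) (x y : X) :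
    h.affinePerm p x * h.affinePerm p y =
      h.affinePerm p (r (x, y)).1 * h.affinePerm p (r (x, y)).2 := by
  classical
  have key (a b : X) (v : X → ZMod p) : (h.affinePerm p a * h.affinePerm p b) v =
      Pi.single a 1 + Pi.single (h.leftPerm a b) 1 +
        v ∘ ⇑(h.leftPerm a * h.leftPerm b)⁻¹ := by
    rw [Equiv.Perm.mul_apply, affinePerm_apply, affinePerm_apply, add_assoc, ← single_comp_inv]
    rfl
  ext1 v
  rw [key, key, ← h.leftPerm_mul, h.leftPerm_fst_snd, h.leftPerm_apply,
    add_comm (Pi.single x (1 : ZMod p) : X → ZMod p)]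

/-- The action of `G(X, r)` on `X → ℤ/p` by the affine maps `v ↦ e_x + v ∘ L_x⁻¹`. -/
noncomputable def IsSolution.affineHom (h : IsSolution r) (p : ℕ) :
    StructureGroup r →* Equiv.Perm (X → ZMod p) :=
  PresentedGroup.toGroup (f := h.affinePerm p) <| by
    rintro _ ⟨x, y, z, t, hr, -, rfl⟩
    have := h.affinePerm_mul p x y
    rw [hr] at this
    simp [this]

theorem IsSolution.affineHom_gen (h : IsSolution r) (p : ℕ) (x : X) :
    h.affineHom p (gen r x) = h.affinePerm p x :=
  PresentedGroup.toGroup.of _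

/-- Since `L_x` fixes `x`, the `k`-th power translates by `k e_x`, which vanishes at `k = p`. -/
theorem IsSolution.affinePerm_pow (h : IsSolution r) (hsf : IsSquareFree r) {p : ℕ} {x : X}
    (hx : h.leftPerm x ^ p = 1) : h.affinePerm p x ^ p = 1 := by
  classical
  have key (k : ℕ) (v : X → ZMod p) :
      (h.affinePerm p x ^ k) v = Pi.single x (k : ZMod p) + v ∘ ⇑(h.leftPerm x ^ k)⁻¹ := by
    induction k with
    | zero => ext; simp
    | succ k ih =>
      have hs := single_comp_inv (h.leftPerm x) x (k : ZMod p)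
      rw [h.leftPerm_self hsf] at hs
      have hc (w w' : X → ZMod p) (f : X → X) : (w + w') ∘ f = w ∘ f + w' ∘ f := rfl
      rw [pow_succ', Equiv.Perm.mul_apply, ih, affinePerm_apply, hc, hs, ← add_assoc,
        ← Pi.single_add, pow_succ', Nat.cast_succ, add_comm (k : ZMod p)]
      rfl
  ext1 v
  rw [key, hx]
  ext; simp

theorem IsSolution.powerSubgroup_le_ker_affineHom (h : IsSolution r) (hsf : IsSquareFree r) {p : ℕ}
    (hp : ∀ x, h.leftPerm x ^ p = 1) : powerSubgroup r p ≤ (h.affineHom p).ker := by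
  refine (Subgroup.closure_le _).2 ?_
  rintro _ ⟨x, rfl⟩
  rw [SetLike.mem_coe, MonoidHom.mem_ker, map_pow, h.affineHom_gen, h.affinePerm_pow hsf (hp x)]

/-- The orbit of `0` under the affine action is everything. -/
theorem IsSolution.exists_affineHom_zero_eq [Fintype X] (h : IsSolution r) (p : ℕ) [NeZero p]
    (v : X → ZMod p) : ∃ g, h.affineHom p g 0 = v := by
  classical
  suffices H : ∀ k, ∀ w : X → ℕ, ∑ x, w x = k →
      ∃ g, h.affineHom p g 0 = fun x => (w x : ZMod p) by
    obtain ⟨g, hg⟩ := H _ (fun x => (v x).val) rfl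
    exact ⟨g, by simpa using hg⟩
  intro k
  induction k with
  | zero =>
    intro w hw
    refine ⟨1, ?_⟩
    ext x
    simp [Finset.sum_eq_zero_iff.1 hw x (Finset.mem_univ x)]
  | succ k ih =>
    intro w hw
    obtain ⟨x, -, hx⟩ : ∃ x ∈ Finset.univ, w x ≠ 0 :=
      Finset.exists_ne_zero_of_sum_ne_zero (by omega)
    obtain ⟨w, rfl⟩ : ∃ w' : X → ℕ, w = Pi.single x 1 + w' := by
      refine ⟨w - Pi.single x 1, (add_tsub_cancel_of_le fun y => ?_).symm⟩
      by_cases hy : y = x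
      · subst hy; simpa using Nat.one_le_iff_ne_zero.2 hx
      · simp [hy]
    -- Twisting by `L_x` in advance cancels the `L_x⁻¹` in the action of `x`; the coordinate sum is
    -- unchanged.
    obtain ⟨g, hg⟩ := ih (w ∘ h.leftPerm x) (by
      simp only [Pi.add_apply, Finset.sum_add_distrib, Finset.sum_pi_single', Finset.mem_univ,
        if_true] at hw
      have := Equiv.sum_comp (h.leftPerm x) w
      simp only [Function.comp_apply]
      omega)
    refine ⟨gen r x * g, ?_⟩
    rw [map_mul, Equiv.Perm.mul_apply, hg, h.affineHom_gen, h.affinePerm_apply]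
    ext y
    simp [Pi.single_apply]

end AffineAction

/-! ### Normal forms and counting -/

/-- Modulo the subgroup of `p`-th powers, every element is an ordered monomial with exponents
smaller than `p`. -/
theorem exists_mem_Y_mul (h : IsSolution r) (hsf : IsSquareFree r) {n : ℕ} {e : Fin n ≃ X}
    (he : IsBinomialEnumeration r e) {p : ℕ} (hp0 : 0 < p) (hp : ∀ x, h.leftPerm x ^ p = 1)
    (u : StructureGroup r) :
    ∃ y ∈ Y r e p, ∃ W ∈ powerSubgroup r p, u = y * W := by
  have := powerSubgroup_normal h hsf hp
  let π := QuotientGroup.mk' (powerSubgroup r p)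
  let g : Fin n → StructureGroup r ⧸ powerSubgroup r p := fun i => π (gen r (e i))
  have hgp (i : Fin n) : g i ^ p = 1 := by
    rw [← map_pow]
    exact (QuotientGroup.eq_one_iff _).2 (Subgroup.subset_closure ⟨e i, rfl⟩)
  have hg (i j : Fin n) (hij : i < j) : ∃ i' j', i' < j ∧ g j * g i = g i' * g j' := by
    refine ⟨e.symm (r (e j, e i)).1, e.symm (r (e j, e i)).2,
      (he i j _ (e.symm (r (e j, e i)).2) hij (by simp)).2, ?_⟩
    simp only [g, Equiv.apply_symm_apply, ← map_mul]
    rw [gen_mul_gen]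
  have hcl : Subgroup.closure (Set.range g) = ⊤ := by
    have hr : Set.range g = π '' Set.range (gen r) := by
      rw [← Set.range_comp, ← e.surjective.range_comp]; rfl
    rw [hr, ← MonoidHom.map_closure, closure_range_gen,
      Subgroup.map_top_of_surjective _ (QuotientGroup.mk'_surjective _)]
  -- Generators of finite order: inverses are positive powers, so positive words suffice.
  have hsub := Subgroup.closure_toSubmonoid_of_isOfFinOrder (s := Set.range g) (by
    rintro _ ⟨i, rfl⟩
    exact isOfFinOrder_iff_pow_eq_one.2 ⟨p, hp0, hgp i⟩)
  have hu : π u ∈ Submonoid.closure (Set.range g) := by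
    rw [← hsub, hcl]; trivial
  obtain ⟨l, hl, hlu⟩ := Submonoid.exists_list_of_mem_closure hu
  obtain ⟨l, rfl⟩ : l ∈ Set.range (List.map g) := by
    rw [Set.range_list_map]; exact hl
  obtain ⟨l', hs, hprod⟩ := exists_sorted_prod_eq hg l
  rw [hprod, prod_map_eq_prod_ofFn_pow_count hs] at hlu
  have hmon : π (orderedMonomial r e fun i => l'.count i % p) = π u := by
    rw [← hlu, orderedMonomial, map_list_prod, List.map_ofFn]
    congr 2
    ext1 i
    simp only [Function.comp_apply, map_pow]
    exact (pow_eq_pow_mod _ (hgp i)).symm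
  exact ⟨_, ⟨_, fun i => Nat.mod_lt _ hp0, rfl⟩, _, QuotientGroup.eq.1 hmon,
    (mul_inv_cancel_left _ _).symm⟩

/-- Ordered monomials with exponents smaller than `p` are determined by the exponents, even modulo
the subgroup of `p`-th powers. -/
theorem orderedMonomial_bijective [Fintype X] (h : IsSolution r) (hsf : IsSquareFree r) {n : ℕ}
    {e : Fin n ≃ X} (he : IsBinomialEnumeration r e) {p : ℕ} [NeZero p]
    (hp : ∀ x, h.leftPerm x ^ p = 1) :
    Function.Bijective fun α : Fin n → Fin p =>
      h.affineHom p (orderedMonomial r e fun i => α i) 0 := by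
  classical
  -- Injectivity comes from surjectivity, both sides having `p^n` elements.
  refine (Fintype.bijective_iff_surjective_and_card _).2 ⟨fun v => ?_, ?_⟩
  · obtain ⟨g, rfl⟩ := h.exists_affineHom_zero_eq p v
    obtain ⟨_, ⟨α, hα, rfl⟩, W, hW, rfl⟩ := exists_mem_Y_mul h hsf he (NeZero.pos p) hp g
    refine ⟨fun i => ⟨α i, hα i⟩, ?_⟩
    have hW1 : h.affineHom p W = 1 := h.powerSubgroup_le_ker_affineHom hsf hp hW
    simp [hW1]
  · simp [Fintype.card_congr e.symm, ZMod.card]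

theorem Y_eq_range (r : X × X → X × X) {n : ℕ} (e : Fin n ≃ X) (p : ℕ) :
    Y r e p = Set.range fun α : Fin n → Fin p => orderedMonomial r e fun i => α i := by
  ext u
  constructor
  · rintro ⟨α, hα, rfl⟩
    exact ⟨fun i => ⟨α i, hα i⟩, rfl⟩
  · rintro ⟨α, rfl⟩
    exact ⟨fun i => α i, fun i => (α i).2, rfl⟩

end Solution

end YBE

theorem theoremA {X : Type*} [Fintype X] (r : X × X → X × X)
    (hr : YBE.IsSolution r) (hsf : YBE.IsSquareFree r)
    (n : ℕ) (e : Fin n ≃ X) (he : YBE.IsBinomialEnumeration r e)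
    (p : ℕ) (hp : p = hr.cyclicDegree) :
    (∀ u : YBE.StructureGroup r,
      ∃! q : YBE.StructureGroup r × YBE.StructureGroup r,
        q.1 ∈ YBE.Y r e p ∧ q.2 ∈ YBE.powerSubgroup r p ∧ u = q.1 * q.2) ∧
    (∀ y ∈ YBE.Y r e p, ∀ z ∈ YBE.Y r e p,
      ∃! q : YBE.StructureGroup r × YBE.StructureGroup r,
        q.1 ∈ YBE.Y r e p ∧ q.2 ∈ YBE.powerSubgroup r p ∧ y * z = q.1 * q.2) ∧
    ((YBE.Y r e p).ncard = p ^ n ∧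
      (⋃ y ∈ YBE.Y r e p, y • (YBE.powerSubgroup r p : Set (YBE.StructureGroup r))) = Set.univ ∧
      ∀ y ∈ YBE.Y r e p, ∀ t ∈ YBE.Y r e p, y ≠ t →
        (y • (YBE.powerSubgroup r p : Set (YBE.StructureGroup r))) ∩
          (t • (YBE.powerSubgroup r p : Set (YBE.StructureGroup r))) = ∅) := by
  have hp0 : 0 < p := hp ▸ hr.cyclicDegree_pos
  have hL (x : X) : hr.leftPerm x ^ p = 1 := hp ▸ hr.leftPerm_pow_cyclicDegree x
  have : NeZero p := ⟨hp0.ne'⟩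
  have hinj := (YBE.orderedMonomial_bijective hr hsf he hL).injective
  have hex := YBE.exists_mem_Y_mul hr hsf he hp0 hL
  have huniq : ∀ y ∈ YBE.Y r e p, ∀ t ∈ YBE.Y r e p, ∀ W ∈ YBE.powerSubgroup r p,
      ∀ W' ∈ YBE.powerSubgroup r p, y * W = t * W' → y = t := by
    intro y hy t ht W hW W' hW' heq
    rw [YBE.Y_eq_range] at hy ht
    obtain ⟨α, rfl⟩ := hy
    obtain ⟨β, rfl⟩ := ht
    have h1 : hr.affineHom p W = 1 := hr.powerSubgroup_le_ker_affineHom hsf hL hW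
    have h2 : hr.affineHom p W' = 1 := hr.powerSubgroup_le_ker_affineHom hsf hL hW'
    -- `W` and `W'` act trivially, so both monomials send `0` to the same point.
    have h3 := congrArg (fun u => hr.affineHom p u 0) heq
    simp only [map_mul, h1, h2, mul_one] at h3
    rw [hinj h3]
  have hone : ∀ u : YBE.StructureGroup r,
      ∃! q : YBE.StructureGroup r × YBE.StructureGroup r,
        q.1 ∈ YBE.Y r e p ∧ q.2 ∈ YBE.powerSubgroup r p ∧ u = q.1 * q.2 := by
    intro u
    obtain ⟨y, hy, W, hW, rfl⟩ := hex u
    refine ⟨(y, W), ⟨hy, hW, rfl⟩, ?_⟩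
    rintro ⟨t, W'⟩ ⟨ht, hW', heq⟩
    obtain rfl := huniq y hy t ht W hW W' hW' heq
    rw [mul_left_cancel heq]
  refine ⟨hone, fun y _ z _ => hone (y * z), ?_, ?_, ?_⟩
  · rw [YBE.Y_eq_range, ← Set.image_univ, Set.ncard_image_of_injective, Set.ncard_univ]
    · simp
    · exact fun α β hαβ => hinj (congrArg (fun u => hr.affineHom p u 0) hαβ)
  · refine Set.eq_univ_of_forall fun u => ?_
    obtain ⟨y, hy, W, hW, rfl⟩ := hex u
    exact Set.mem_biUnion hy (Set.smul_mem_smul_set hW)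
  · intro y hy t ht hyt
    refine Set.eq_empty_of_forall_notMem ?_
    rintro _ ⟨⟨W, hW, rfl⟩, ⟨W', hW', heq⟩⟩
    exact hyt (huniq y hy t ht W hW W' hW' heq.symm)
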